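/- Let $\mathcal P_2(\mathbb R)$ be the set of Borel probability measures on $\mathbb R$ with finite second moment, with the Wasserstein distance $W_2$, and let $\Gamma_0(\mu,\nu)$ be the set of transport plans between $\mu$ and $\nu$ that are optimal for the cost $|x-y|^2$. Let $W:\mathbb R\to\mathbb R$ be continuous and even, with $W(0)=0$, $W\in C^1(\mathbb R\setminus\{0\})$, $W(z)\le C(1+z^2)$ for some $C>0$ and all $z$, and such that $W(x)+\frac{\lambda''}{2}x^2+\lambda'|x|$ is convex for some $\lambda',\lambda''\ge 0$. Suppose that $W(x)=\overline W(x)+\eta|x|$ with $\overline W\in C^1(\mathbb R)$ and $\eta<0$. Set $$\mathcal W[\mu]=\frac12\int_{\mathbb R\times\mathbb R}W(x-y)\,d\mu(x)\,d\mu(y),\qquad k_\mu(x)=\int_{y\neq x}W'(x-y)\,d\mu(y).$$ For $\mu\in\mathcal P_2(\mathbb R)$, the subdifferential $\partial\mathcal W[\mu]$ is the set of $k\in L^2(\mu)$ such that, as $\nu\to\mu$ in $(\mathcal P_2(\mathbb R),W_2)$, $$\mathcal W[\nu]-\mathcal W[\mu]\ \ge\ \inf_{\gamma\in\Gamma_0(\mu,\nu)}\int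 k(x)(y-x)\,d\gamma(x,y)+o(W_2(\mu,\nu)).$$ 1. If $\mu\in\mathcal P_2(\mathbb R)$ and there is $\bar x\in\mathbb R$ with $\mu(\{\bar x\})>0$, then $k_\mu\notin\partial\mathcal W[\mu]$. 2. Consequently, atoms cannot persist under the flow: if $(\mu_t)_{t>0}$ is a gradient flow of $\mathcal W$, then $\mu_t$ has no atoms for a.e. $t>0$. Here a gradient flow is a curve in $AC^2_{loc}((0,\infty);\mathcal P_2(\mathbb R))$ for which there is a Borel field $v_t(x)$ with $t\mapsto\|v_t\|_{L^2(\mu_t)}$ in $L^2_{loc}(0,\infty)$, with $\partial_t\mu_t+\partial_x(v_t\mu_t)=0$ in the sense of distributions on $(0,\infty)\times\mathbb R$, and such that for a.e. $t>0$ the field $v_t$ lies in the $L^2(\mu_t)$-closure of $\{\zeta':\zeta\in C_c^\infty(\mathbb R)\}$ and $-v_t\in\partial\mathcal W[\mu_t]$. -/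

import Mathlib

open MeasureTheory Set
open scoped ENNReal ContDiff

noncomputable section

namespace OneDimInteraction

/-- `μ ∈ 𝒫₂(ℝ)`: a Borel probability measure on `ℝ` with finite quadratic moment. -/
structure IsP2 (μ : Measure ℝ) : Prop where
  isProbabilityMeasure : IsProbabilityMeasure μ
  moment : MemLp (fun x : ℝ => x) 2 μ

/-- The transport plans `Γ(μ, ν)`. -/
def plans (μ ν : Measure ℝ) : Set (Measure (ℝ × ℝ)) :=
  {γ | γ.map Prod.fst = μ ∧ γ.map Prod.snd = ν}

/-- The quadratic transport cost `∫ |x - y|² dγ(x, y)`, with values in `[0, ∞]`. -/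
def cost (γ : Measure (ℝ × ℝ)) : ℝ≥0∞ :=
  ∫⁻ p, ENNReal.ofReal ((p.1 - p.2) ^ 2) ∂γ

/-- The optimal plans `Γ₀(μ, ν)`: the transport plans of minimal quadratic cost. -/
def optimalPlans (μ ν : Measure ℝ) : Set (Measure (ℝ × ℝ)) :=
  {γ | γ ∈ plans μ ν ∧ ∀ γ' ∈ plans μ ν, cost γ ≤ cost γ'}

/-- The Wasserstein distance `W₂(μ, ν)`; the infimum is finite when `μ, ν ∈ 𝒫₂(ℝ)`. -/
def W2 (μ ν : Measure ℝ) : ℝ :=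
  Real.sqrt (⨅ γ ∈ plans μ ν, cost γ).toReal

/-- The Fréchet subdifferential `∂φ(μ)` of a functional `φ` on `𝒫₂(ℝ)`: the fields `k ∈ L²(μ)` with
`φ(ν) - φ(μ) ≥ inf_{γ ∈ Γ₀(μ, ν)} ∫ k(x) (y - x) dγ(x, y) + o(W₂(μ, ν))` as `ν → μ` in `𝒫₂(ℝ)`. -/
def subdifferential (φ : Measure ℝ → ℝ) (μ : Measure ℝ) : Set (ℝ → ℝ) :=
  {k | MemLp k 2 μ ∧
    ∀ ε : ℝ, 0 < ε → ∃ δ : ℝ, 0 < δ ∧ ∀ ν : Measure ℝ, IsP2 ν → W2 μ ν < δ →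
      sInf ((fun γ : Measure (ℝ × ℝ) => ∫ p, k p.1 * (p.2 - p.1) ∂γ) '' optimalPlans μ ν)
          - ε * W2 μ ν ≤ φ ν - φ μ}

/-- The standing assumptions on the interaction potential, in dimension one. -/
structure IsPotential (W : ℝ → ℝ) : Prop where
  continuous : Continuous W
  even : ∀ x, W (-x) = W x
  zero : W 0 = 0
  contDiffOn : ContDiffOn ℝ 1 W {0}ᶜ
  growth : ∃ C : ℝ, 0 < C ∧ ∀ z, W z ≤ C * (1 + z ^ 2)
  convex : ∃ l₁ l₂ : ℝ, 0 ≤ l₁ ∧ 0 ≤ l₂ ∧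
    ConvexOn ℝ univ (fun x : ℝ => W x + l₂ / 2 * x ^ 2 + l₁ * |x|)

/-- The interaction energy `𝒲[μ] = ½ ∬ W(x - y) dμ(x) dμ(y)`. -/
def energy (W : ℝ → ℝ) (μ : Measure ℝ) : ℝ :=
  1 / 2 * ∫ p : ℝ × ℝ, W (p.1 - p.2) ∂(μ.prod μ)

/-- The field `k(x) = ∫_{y ≠ x} W'(x - y) dμ(y)`. -/
def field (W : ℝ → ℝ) (μ : Measure ℝ) (x : ℝ) : ℝ :=
  ∫ y in {x}ᶜ, deriv W (x - y) ∂μ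

/-- `μ ∈ AC²_loc((0, ∞); 𝒫₂(ℝ))`. -/
def IsAC2loc (μ : ℝ → Measure ℝ) : Prop :=
  (∀ t, 0 < t → IsP2 (μ t)) ∧
  ∀ a b : ℝ, 0 < a → a < b →
    ∃ m : ℝ → ℝ, MemLp m 2 (volume.restrict (Ioo a b)) ∧
      ∀ s t : ℝ, a < s → s ≤ t → t < b → W2 (μ s) (μ t) ≤ ∫ r in s..t, m r

/-- The tangent space at `μ`: the `L²(μ)`-closure of `{ζ' : ζ ∈ C_c^∞(ℝ)}`. -/
def tangent (μ : Measure ℝ) : Set (ℝ → ℝ) :=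
  {w | MemLp w 2 μ ∧ ∀ ε : ℝ≥0∞, 0 < ε → ∃ ζ : ℝ → ℝ, ContDiff ℝ ∞ ζ ∧ HasCompactSupport ζ ∧
    eLpNorm (fun x => w x - deriv ζ x) 2 μ < ε}

/-- The continuity equation `∂ₜ μ + ∂ₓ (v μ) = 0` in the sense of distributions on
`(0, ∞) × ℝ`. -/
def SolvesContinuityEq (μ : ℝ → Measure ℝ) (v : ℝ → ℝ → ℝ) : Prop :=
  ∀ φ : ℝ × ℝ → ℝ, ContDiff ℝ ∞ φ → HasCompactSupport φ → tsupport φ ⊆ Ioi 0 ×ˢ univ →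
    ∫ t in Ioi (0 : ℝ), (∫ x, (deriv (fun τ => φ (τ, x)) t
      + v t x * deriv (fun y => φ (t, y)) x) ∂(μ t)) = 0

/-- `μ` is a gradient flow of `φ`: it is a curve in `AC²_loc((0, ∞); 𝒫₂(ℝ))` whose velocity field,
i.e. the tangent field `v` with `‖v_t‖_{L²(μ_t)} ∈ L²_loc` that solves the continuity equation,
satisfies `v_t ∈ -∂φ(μ_t)` for a.e. `t > 0`. -/
def IsGradientFlow (φ : Measure ℝ → ℝ) (μ : ℝ → Measure ℝ) : Prop :=
  IsAC2loc μ ∧ ∃ v : ℝ → ℝ → ℝ,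
    Measurable (Function.uncurry v) ∧
    (∀ a b : ℝ, 0 < a → a < b →
      ∫⁻ t in Ioo a b, (∫⁻ x, ENNReal.ofReal (v t x ^ 2) ∂(μ t)) < ⊤) ∧
    (∀ᵐ t ∂(volume.restrict (Ioi (0 : ℝ))), v t ∈ tangent (μ t)) ∧
    SolvesContinuityEq μ v ∧
    ∀ᵐ t ∂(volume.restrict (Ioi (0 : ℝ))), (fun x => -v t x) ∈ subdifferential φ (μ t)

end OneDimInteraction

end

open OneDimInteraction

open Filter Topology

namespace OneDimInteraction

/-! ### Functions of quadratic growth -/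

/-! At a measure with an atom at `a` the whole subdifferential is empty. Write `2m` for the mass of
the atom and split it symmetrically into `a ± h`, at `W2` distance at most `h`. The two halves now
repel: their interaction adds `m² W(2h)`, equal to `2 η m² h + o(h)` with `η < 0`. Interaction with
the remaining mass changes by a second difference, which is `o(h)` from the `C¹` part and
nonpositive from `η|x|`. So the energy drops at a linear rate
(`eventually_energy_splitAtom_sub_le`).

The linear term cannot account for this drop. The optimal plan need not be the splitting plan, so it
is not computed. Instead `k` is approximated in `L²(μ)` by a smooth `g = G'`. Then `∫ g(x)(y - x)
dγ` is `∫ (G(y) - G(x)) dγ` up to `O(h²)`, which depends only on the marginals, and its first-order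
part cancels by symmetry (`linear_term_splitAtom`).

Both claims follow; for a gradient flow, `-v_t` lies in the subdifferential for a.e. `t`. -/

lemma abs_le_one_add_sq (z : ℝ) : |z| ≤ 1 + z ^ 2 := by
  rw [← sq_abs z]
  nlinarith [sq_nonneg (|z| - 1), abs_nonneg z]

lemma IsP2.integrable_sq {μ : Measure ℝ} (hμ : IsP2 μ) : Integrable (fun x : ℝ => x ^ 2) μ :=
  hμ.moment.integrable_sq

lemma IsP2.integrable_of_growth {μ : Measure ℝ} (hμ : IsP2 μ) {F : ℝ → ℝ} (hF : Continuous F)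
    {C : ℝ} (hC : ∀ z, |F z| ≤ C * (1 + z ^ 2)) : Integrable F μ := by
  have := hμ.isProbabilityMeasure
  refine (((integrable_const (1 : ℝ)).add hμ.integrable_sq).const_mul C).mono'
    hF.aestronglyMeasurable (Eventually.of_forall fun x => ?_)
  simpa using hC x

/-- A function of quadratic growth stays so after a translation. -/
lemma growth_translate {F : ℝ → ℝ} {C : ℝ} (hC0 : 0 ≤ C) (hC : ∀ z, |F z| ≤ C * (1 + z ^ 2))
    (a : ℝ) (y : ℝ) : |F (a - y)| ≤ C * (2 + 2 * a ^ 2) * (1 + y ^ 2) := by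
  refine (hC _).trans ?_
  rw [mul_assoc]
  refine mul_le_mul_of_nonneg_left ?_ hC0
  nlinarith [sq_nonneg (a + y), mul_nonneg (sq_nonneg a) (sq_nonneg y), sq_nonneg y]

lemma integrable_prod_of_growth {α β : Measure ℝ} [IsFiniteMeasure α] [IsFiniteMeasure β]
    (hα : Integrable (fun x : ℝ => x ^ 2) α) (hβ : Integrable (fun x : ℝ => x ^ 2) β)
    {F : ℝ → ℝ} (hF : Continuous F) {C : ℝ} (hC0 : 0 ≤ C) (hC : ∀ z, |F z| ≤ C * (1 + z ^ 2)) :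
    Integrable (fun p : ℝ × ℝ => F (p.1 - p.2)) (α.prod β) := by
  have h1 : Integrable (fun p : ℝ × ℝ => p.1 ^ 2) (α.prod β) := hα.comp_fst β
  have h2 : Integrable (fun p : ℝ × ℝ => p.2 ^ 2) (α.prod β) := hβ.comp_snd α
  refine ((((integrable_const (1 : ℝ)).add (h1.const_mul 2)).add (h2.const_mul 2)).const_mul C).mono'
    (by fun_prop) (Eventually.of_forall fun p => ?_)
  refine (hC _).trans (mul_le_mul_of_nonneg_left ?_ hC0)
  simp only [Pi.add_apply]
  nlinarith [sq_nonneg (p.1 + p.2)]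

/-! ### Splitting an atom -/

/-- The measure obtained from `μ` by moving one half of the mass at `a` to `a + h` and the other
half to `a - h`. -/
noncomputable def splitAtom (μ : Measure ℝ) (a h : ℝ) : Measure ℝ :=
  μ.restrict {a}ᶜ + (μ {a} / 2) • (Measure.dirac (a + h) + Measure.dirac (a - h))

/-- The transport plan from `μ` to `splitAtom μ a h` which splits the atom and leaves the rest of
the mass where it is. -/
noncomputable def splitPlan (μ : Measure ℝ) (a h : ℝ) : Measure (ℝ × ℝ) :=
  (μ.restrict {a}ᶜ).map (fun x => (x, x)) +
    (μ {a} / 2) • (Measure.dirac (a, a + h) + Measure.dirac (a, a - h))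

/-- Makes the formulas for the split measure apply to `μ` itself, so that increments are differences
of one formula at `h` and at `0`. -/
lemma splitAtom_zero (μ : Measure ℝ) (a : ℝ) : splitAtom μ a 0 = μ := by
  rw [splitAtom, add_zero, sub_zero, ← two_smul ℝ≥0∞, smul_smul,
    ENNReal.div_mul_cancel (by norm_num) (by norm_num), ← Measure.restrict_singleton,
    Measure.restrict_compl_add_restrict (measurableSet_singleton a)]

lemma splitPlan_mem_plans (μ : Measure ℝ) (a h : ℝ) :
    splitPlan μ a h ∈ plans μ (splitAtom μ a h) := by
  constructor
  · conv_rhs => rw [← splitAtom_zero μ a]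
    rw [splitPlan, splitAtom, Measure.map_add _ _ measurable_fst, Measure.map_smul,
      Measure.map_add _ _ measurable_fst, Measure.map_dirac' measurable_fst,
      Measure.map_dirac' measurable_fst, Measure.map_map measurable_fst (by fun_prop)]
    simp [Function.comp_def]
  · rw [splitPlan, splitAtom, Measure.map_add _ _ measurable_snd, Measure.map_smul,
      Measure.map_add _ _ measurable_snd, Measure.map_dirac' measurable_snd,
      Measure.map_dirac' measurable_snd, Measure.map_map measurable_snd (by fun_prop)]
    simp [Function.comp_def]

lemma cost_splitPlan_le (μ : Measure ℝ) [IsProbabilityMeasure μ] (a h : ℝ) :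
    cost (splitPlan μ a h) ≤ ENNReal.ofReal (h ^ 2) := by
  have hm : Measurable fun p : ℝ × ℝ => ENNReal.ofReal ((p.1 - p.2) ^ 2) := by fun_prop
  rw [cost, splitPlan, lintegral_add_measure, lintegral_smul_measure, lintegral_add_measure,
    lintegral_map hm (by fun_prop), lintegral_dirac' _ hm, lintegral_dirac' _ hm]
  simp only [sub_self, sub_add_cancel_left, sub_sub_cancel, even_two, Even.neg_pow]
  simp only [ne_eq, OfNat.ofNat_ne_zero, not_false_eq_true, zero_pow, ENNReal.ofReal_zero,
    lintegral_const, zero_mul, zero_add, smul_eq_mul]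
  rw [← two_mul, ← mul_assoc, ENNReal.div_mul_cancel (by norm_num) (by norm_num)]
  exact mul_le_of_le_one_left' prob_le_one

lemma iInf_cost_splitAtom_le (μ : Measure ℝ) [IsProbabilityMeasure μ] (a h : ℝ) :
    ⨅ γ ∈ plans μ (splitAtom μ a h), cost γ ≤ ENNReal.ofReal (h ^ 2) :=
  (iInf₂_le _ (splitPlan_mem_plans μ a h)).trans (cost_splitPlan_le μ a h)

lemma W2_splitAtom_le (μ : Measure ℝ) [IsProbabilityMeasure μ] (a : ℝ) {h : ℝ} (hh : 0 ≤ h) :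
    W2 μ (splitAtom μ a h) ≤ h := by
  rw [W2]
  refine (Real.sqrt_le_left hh).2 ?_
  exact ENNReal.toReal_le_of_le_ofReal (by positivity) (iInf_cost_splitAtom_le μ a h)

lemma integrable_splitAtom {μ : Measure ℝ} [IsFiniteMeasure μ] {a : ℝ} {F : ℝ → ℝ} (h : ℝ)
    (hF : Integrable F (μ.restrict {a}ᶜ)) : Integrable F (splitAtom μ a h) := by
  refine hF.add_measure (Integrable.smul_measure (Integrable.add_measure ?_ ?_) ?_)
  · exact integrable_dirac (by simp)
  · exact integrable_dirac (by simp)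
  · exact ENNReal.div_ne_top (measure_ne_top _ _) (by norm_num)

lemma integral_splitAtom {μ : Measure ℝ} [IsFiniteMeasure μ] {a : ℝ} {F : ℝ → ℝ} (h : ℝ)
    (hF : Integrable F (μ.restrict {a}ᶜ)) :
    ∫ x, F x ∂(splitAtom μ a h) =
      ∫ x, F x ∂(μ.restrict {a}ᶜ) + μ.real {a} / 2 * (F (a + h) + F (a - h)) := by
  have hd : ∀ b, Integrable F (Measure.dirac b) := fun b => integrable_dirac (by simp)
  rw [splitAtom, integral_add_measure hF (((hd _).add_measure (hd _)).smul_measure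
    (ENNReal.div_ne_top (measure_ne_top _ _) (by norm_num))), integral_smul_measure,
    integral_add_measure (hd _) (hd _), integral_dirac, integral_dirac]
  simp [Measure.real, ENNReal.toReal_div]

lemma isP2_splitAtom {μ : Measure ℝ} (hμ : IsP2 μ) (a h : ℝ) : IsP2 (splitAtom μ a h) := by
  have := hμ.isProbabilityMeasure
  constructor
  · have h1 : (splitPlan μ a h).map Prod.fst = μ := (splitPlan_mem_plans μ a h).1
    have h2 := (splitPlan_mem_plans μ a h).2
    rw [← h2]
    have : IsProbabilityMeasure (splitPlan μ a h) := by
      constructor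
      rw [← preimage_univ (f := Prod.fst), ← Measure.map_apply measurable_fst .univ, h1,
        measure_univ]
    exact Measure.isProbabilityMeasure_map measurable_snd.aemeasurable
  · rw [memLp_two_iff_integrable_sq (by fun_prop)]
    exact integrable_splitAtom h hμ.integrable_sq.restrict

/-! ### The linear term along the splitting -/

/-- A smooth compactly supported `g` has a primitive with a uniform quadratic remainder. -/
lemma exists_primitive_quadratic_remainder {g : ℝ → ℝ} (hg : ContDiff ℝ ∞ g)
    (hgc : HasCompactSupport g) :
    ∃ (G : ℝ → ℝ) (K : ℝ), Continuous G ∧ 0 ≤ K ∧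
      ∀ x y, |G y - G x - g x * (y - x)| ≤ K * (y - x) ^ 2 := by
  obtain ⟨K, hK⟩ := hgc.deriv.exists_bound_of_continuous (hg.continuous_deriv (by simp))
  have hlip : ∀ x u, |g u - g x| ≤ K * |u - x| := fun x u =>
    Convex.norm_image_sub_le_of_norm_deriv_le (s := univ)
      (fun z _ => (hg.differentiable (by simp)).differentiableAt) (fun z _ => hK z) convex_univ
      (mem_univ x) (mem_univ u)
  have hK0 : 0 ≤ K := (norm_nonneg _).trans (hK 0)
  have hgi : ∀ x y, IntervalIntegrable g volume x y := fun x y =>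
    hg.continuous.intervalIntegrable x y
  refine ⟨fun x => ∫ u in (0 : ℝ)..x, g u,
    K, intervalIntegral.continuous_primitive hgi 0, hK0, fun x y => ?_⟩
  have : (∫ u in (0 : ℝ)..y, g u) - (∫ u in (0 : ℝ)..x, g u) - g x * (y - x)
      = ∫ u in x..y, (g u - g x) := by
    rw [intervalIntegral.integral_interval_sub_left (hgi _ _) (hgi _ _),
      intervalIntegral.integral_sub (hgi _ _) intervalIntegrable_const,
      intervalIntegral.integral_const, smul_eq_mul, mul_comm]
  rw [this]
  refine (intervalIntegral.norm_integral_le_of_norm_le_const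
    (f := fun u => g u - g x) (C := K * |y - x|) fun u hu => (hlip x u).trans ?_).trans_eq ?_
  · exact mul_le_mul_of_nonneg_left (abs_sub_left_of_mem_uIcc (uIoc_subset_uIcc hu)) hK0
  · rw [mul_assoc, abs_mul_abs_self, sq]

/-- Approximation of an `L²` function by smooth functions, in integral form. -/
lemma exists_smooth_integral_sq_sub_le {μ : Measure ℝ} [IsFiniteMeasure μ] {k : ℝ → ℝ}
    (hk : MemLp k 2 μ) {ε : ℝ} (hε : 0 < ε) :
    ∃ g : ℝ → ℝ, HasCompactSupport g ∧ ContDiff ℝ ∞ g ∧ MemLp (fun x => k x - g x) 2 μ ∧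
      ∫ x, (k x - g x) ^ 2 ∂μ ≤ ε ^ 2 := by
  obtain ⟨g, hgc, hg, hle⟩ := hk.exist_eLpNorm_sub_le (by norm_num) (by norm_num) hε
  have hkg : MemLp (k - g) 2 μ := hk.sub (hg.continuous.memLp_of_hasCompactSupport hgc)
  refine ⟨g, hgc, hg, hkg, ?_⟩
  rw [hkg.eLpNorm_eq_integral_rpow_norm (by norm_num) (by norm_num),
    ENNReal.ofReal_le_ofReal_iff hε.le] at hle
  have h0 : 0 ≤ ∫ x, (k x - g x) ^ 2 ∂μ := integral_nonneg fun x => sq_nonneg _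
  have : (∫ x, (k x - g x) ^ 2 ∂μ) ^ (2⁻¹ : ℝ) ≤ ε := by simpa using hle
  rw [← one_div, ← Real.sqrt_eq_rpow] at this
  exact (Real.sqrt_le_left hε.le).1 this

/-- Along the splitting of an atom, the linear term of every sufficiently cheap plan is of
lower order than the displacement. -/
lemma linear_term_splitAtom {μ : Measure ℝ} (hμ : IsP2 μ) {k : ℝ → ℝ} (hk : MemLp k 2 μ) (a : ℝ)
    {ε : ℝ} (hε : 0 < ε) :
    ∃ K : ℝ, 0 ≤ K ∧ ∀ h : ℝ, 0 < h → ∀ γ ∈ plans μ (splitAtom μ a h),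
      cost γ ≤ ENNReal.ofReal (h ^ 2) →
        -(ε * h + K * h ^ 2) ≤ ∫ p, k p.1 * (p.2 - p.1) ∂γ := by
  have := hμ.isProbabilityMeasure
  obtain ⟨g, hgc, hg, hkg, hint⟩ := exists_smooth_integral_sq_sub_le hk hε
  obtain ⟨G, K, hGc, hK, hG⟩ := exists_primitive_quadratic_remainder hg hgc
  -- One `K` pays for replacing `g(x)(y - x)` by `G(y) - G(x)`, the other for the increment of `∫ G`
  -- between the marginals.
  refine ⟨2 * K, by positivity, fun h hh γ hγ hcost => ?_⟩
  have hν := isP2_splitAtom hμ a h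
  have hγ1 : MeasurePreserving Prod.fst γ μ := ⟨measurable_fst, hγ.1⟩
  have hγ2 : MeasurePreserving Prod.snd γ (splitAtom μ a h) := ⟨measurable_snd, hγ.2⟩
  -- growth of the primitive
  have hGg : ∀ y, |G y| ≤ (|G 0| + |g 0| + K) * (1 + y ^ 2) := fun y => by
    have h1 : |G y| ≤ |G 0| + |g 0| * |y| + K * y ^ 2 := by
      have h2 := hG 0 y
      simp only [sub_zero] at h2
      calc |G y| = |(G y - G 0 - g 0 * y) + (G 0 + g 0 * y)| := by ring_nf
        _ ≤ K * y ^ 2 + (|G 0| + |g 0| * |y|) := by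
          rw [← abs_mul]
          exact (abs_add_le _ _).trans (add_le_add h2 (abs_add_le _ _))
        _ = _ := by ring
    have h3 := abs_le_one_add_sq y
    nlinarith [abs_nonneg (G 0), mul_le_mul_of_nonneg_left h3 (abs_nonneg (g 0)),
      mul_nonneg (abs_nonneg (G 0)) (sq_nonneg y)]
  have hGμ : Integrable G μ := hμ.integrable_of_growth hGc hGg
  have hGν : Integrable G (splitAtom μ a h) := hν.integrable_of_growth hGc hGg
  have hG1 : Integrable (fun p : ℝ × ℝ => G p.1) γ := hγ1.integrable_comp_of_integrable hGμ
  have hG2 : Integrable (fun p : ℝ × ℝ => G p.2) γ := hγ2.integrable_comp_of_integrable hGν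
  have hkg2 : Integrable (fun p : ℝ × ℝ => (k p.1 - g p.1) ^ 2) γ :=
    hγ1.integrable_comp_of_integrable hkg.integrable_sq
  have hd : MemLp (fun p : ℝ × ℝ => p.2 - p.1) 2 γ :=
    (hν.moment.comp_measurePreserving hγ2).sub (hμ.moment.comp_measurePreserving hγ1)
  have hkd : Integrable (fun p : ℝ × ℝ => k p.1 * (p.2 - p.1)) γ :=
    MemLp.integrable_mul (hk.comp_measurePreserving hγ1) hd
  have hd2 : ∫ p, (p.2 - p.1) ^ 2 ∂γ ≤ h ^ 2 := by
    rw [integral_eq_lintegral_of_nonneg_ae (Eventually.of_forall fun p => sq_nonneg _)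
      hd.integrable_sq.aestronglyMeasurable]
    refine ENNReal.toReal_le_of_le_ofReal (by positivity) (le_trans (le_of_eq ?_) hcost)
    exact lintegral_congr fun p => by rw [← neg_sub, neg_sq]
  have hkgμ : ∫ p : ℝ × ℝ, (k p.1 - g p.1) ^ 2 ∂γ ≤ ε ^ 2 := by
    rwa [← hγ.1, integral_map measurable_fst.aemeasurable] at hint
    rw [hγ.1]; exact hkg.integrable_sq.aestronglyMeasurable
  -- the potential part
  have hpot : -(K * h ^ 2) ≤ ∫ p, (G p.2 - G p.1) ∂γ := by
    rw [integral_sub hG2 hG1]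
    have e2 : ∫ p : ℝ × ℝ, G p.2 ∂γ = ∫ x, G x ∂(splitAtom μ a h) := by
      rw [← hγ.2, integral_map measurable_snd.aemeasurable hGc.aestronglyMeasurable]
    have e1 : ∫ p : ℝ × ℝ, G p.1 ∂γ = ∫ x, G x ∂(splitAtom μ a 0) := by
      rw [splitAtom_zero, ← hγ.1, integral_map measurable_fst.aemeasurable hGc.aestronglyMeasurable]
    rw [e1, e2, integral_splitAtom h hGμ.restrict, integral_splitAtom 0 hGμ.restrict]
    have hm1 : μ.real {a} ≤ 1 := measureReal_le_one
    have hm0 : 0 ≤ μ.real {a} := measureReal_nonneg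
    have i1 := (abs_le.1 (hG a (a + h))).1
    have i2 := (abs_le.1 (hG a (a - h))).1
    simp only [add_sub_cancel_left, sub_sub_cancel_left, add_zero, sub_zero] at i1 i2 ⊢
    -- The first-order terms `± g(a) h` cancel by the symmetry of the splitting.
    have i3 : -(2 * (K * h ^ 2)) ≤ (G (a + h) + G (a - h)) - (G a + G a) := by nlinarith
    have i4 := mul_le_mul_of_nonneg_left i3 (div_nonneg hm0 zero_le_two)
    have i5 : 0 ≤ K * h ^ 2 := by positivity
    nlinarith
  -- pointwise comparison
  have hpt : ∀ p : ℝ × ℝ, (G p.2 - G p.1) - (h / (2 * ε) * (k p.1 - g p.1) ^ 2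
      + (ε / (2 * h) + K) * (p.2 - p.1) ^ 2) ≤ k p.1 * (p.2 - p.1) := fun p => by
    have j1 := (abs_le.1 (hG p.1 p.2)).2
    -- Young's inequality, weighted so that the bounds `ε²` and `h²` on the two integrals each
    -- contribute `ε h / 2`.
    have j2 : -((k p.1 - g p.1) * (p.2 - p.1)) ≤
        h / (2 * ε) * (k p.1 - g p.1) ^ 2 + ε / (2 * h) * (p.2 - p.1) ^ 2 := by
      have : h / (2 * ε) * (k p.1 - g p.1) ^ 2 + ε / (2 * h) * (p.2 - p.1) ^ 2
          + (k p.1 - g p.1) * (p.2 - p.1)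
          = (h * (k p.1 - g p.1) + ε * (p.2 - p.1)) ^ 2 / (2 * ε * h) := by
        field_simp; ring
      have : 0 ≤ (h * (k p.1 - g p.1) + ε * (p.2 - p.1)) ^ 2 / (2 * ε * h) := by positivity
      linarith
    linarith
  have hmono := integral_mono ((hG2.sub hG1).sub ((hkg2.const_mul (h / (2 * ε))).add
    (hd.integrable_sq.const_mul (ε / (2 * h) + K)))) hkd hpt
  rw [integral_sub' (hG2.sub hG1) ((hkg2.const_mul (h / (2 * ε))).add
    (hd.integrable_sq.const_mul (ε / (2 * h) + K))), integral_add' (hkg2.const_mul (h / (2 * ε)))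
    (hd.integrable_sq.const_mul (ε / (2 * h) + K)), integral_const_mul, integral_const_mul] at hmono
  have k1 : h / (2 * ε) * ∫ p : ℝ × ℝ, (k p.1 - g p.1) ^ 2 ∂γ ≤ h / (2 * ε) * ε ^ 2 :=
    mul_le_mul_of_nonneg_left hkgμ (by positivity)
  have k2 : (ε / (2 * h) + K) * ∫ p : ℝ × ℝ, (p.2 - p.1) ^ 2 ∂γ ≤ (ε / (2 * h) + K) * h ^ 2 :=
    mul_le_mul_of_nonneg_left hd2 (by positivity)
  have k3 : h / (2 * ε) * ε ^ 2 = ε * h / 2 := by field_simp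
  have k4 : (ε / (2 * h) + K) * h ^ 2 = ε * h / 2 + K * h ^ 2 := by field_simp
  have k5 : ∫ p, ((fun p : ℝ × ℝ => G p.2) - fun p : ℝ × ℝ => G p.1) p ∂γ = ∫ p, (G p.2 - G p.1) ∂γ := rfl
  linarith

/-! ### The energy along the splitting -/

/-- A convex even function vanishing at zero is nonnegative. -/
lemma nonneg_of_convexOn_of_even {Φ : ℝ → ℝ} (hΦ : ConvexOn ℝ univ Φ) (he : ∀ x, Φ (-x) = Φ x)
    (h0 : Φ 0 = 0) (x : ℝ) : 0 ≤ Φ x := by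
  have h := hΦ.2 (mem_univ x) (mem_univ (-x)) (by norm_num : (0 : ℝ) ≤ 1 / 2)
    (by norm_num : (0 : ℝ) ≤ 1 / 2) (by norm_num)
  simp only [smul_eq_mul, he] at h
  rw [show 1 / 2 * x + 1 / 2 * -x = 0 by ring, h0] at h
  linarith

/-- The growth assumption only bounds `W` above; the lower bound comes from the convex
regularization, which is even, zero at the origin, hence nonnegative. -/
lemma IsPotential.abs_le {W : ℝ → ℝ} (hW : IsPotential W) :
    ∃ C : ℝ, 0 ≤ C ∧ ∀ z, |W z| ≤ C * (1 + z ^ 2) := by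
  obtain ⟨C, hC, hCW⟩ := hW.growth
  obtain ⟨l₁, l₂, hl₁, hl₂, hconv⟩ := hW.convex
  refine ⟨C + l₂ + l₁, by positivity, fun z => ?_⟩
  have h0 := nonneg_of_convexOn_of_even hconv (fun x => by simp [hW.even]) (by simp [hW.zero]) z
  have h3 := abs_le_one_add_sq z
  have h4 := mul_le_mul_of_nonneg_left h3 hl₁
  have h5 := mul_nonneg hl₂ (sq_nonneg z)
  have h6 := mul_nonneg hC.le (sq_nonneg z)
  have h7 := mul_nonneg hl₁ (sq_nonneg z)
  have h8 := hCW z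
  rw [_root_.abs_le]
  constructor <;> nlinarith

lemma abs_abs_second_difference_le (z h : ℝ) :
    |(|z + h| + |z - h| - 2 * |z|)| ≤ 2 * |h| := by
  have h1 := abs_le.1 (abs_abs_sub_abs_le_abs_sub (z + h) z)
  have h2 := abs_le.1 (abs_abs_sub_abs_le_abs_sub (z - h) z)
  rw [add_sub_cancel_left] at h1
  rw [sub_sub_cancel_left, abs_neg] at h2
  rw [abs_le]
  constructor <;> linarith [h1.1, h1.2, h2.1, h2.2]

/-- The second differences of the potential are of first order, with quadratic growth. -/
lemma IsPotential.second_difference_le {W : ℝ → ℝ} (hW : IsPotential W) :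
    ∃ C : ℝ, 0 ≤ C ∧ ∀ z h, 0 < h → h ≤ 1 →
      |W (z + h) + W (z - h) - 2 * W z| ≤ C * (1 + z ^ 2) * h := by
  obtain ⟨C, hC, hCW⟩ := hW.abs_le
  obtain ⟨l₁, l₂, hl₁, hl₂, hconv⟩ := hW.convex
  set Φ : ℝ → ℝ := fun x => W x + l₂ / 2 * x ^ 2 + l₁ * |x| with hΦ
  have hΦ0 := nonneg_of_convexOn_of_even hconv
    (fun x => by simp [hΦ, hW.even]) (by simp [hΦ, hW.zero])
  have hΦle : ∀ z, Φ z ≤ (C + l₂ + l₁) * (1 + z ^ 2) := fun z => by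
    have h3 := abs_le_one_add_sq z
    have h4 := mul_le_mul_of_nonneg_left h3 hl₁
    have h5 := mul_nonneg hl₂ (sq_nonneg z)
    have h8 := (_root_.abs_le.1 (hCW z)).2
    simp only [hΦ]
    nlinarith
  refine ⟨6 * (C + l₂ + l₁) + l₂ + 2 * l₁, by positivity, fun z h hh hh1 => ?_⟩
  -- For `h ≤ 1`, convexity bounds the increments at step `h` by `h` times those at step `1`, which
  -- the growth of `Φ` controls.
  have hstep : ∀ s : ℝ, Φ (z + h * s) ≤ (1 - h) * Φ z + h * Φ (z + s) := fun s => by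
    have := hconv.2 (mem_univ z) (mem_univ (z + s)) (sub_nonneg.2 hh1) hh.le (by ring)
    simp only [smul_eq_mul] at this
    rwa [show (1 - h) * z + h * (z + s) = z + h * s by ring] at this
  have hmid : 2 * Φ z ≤ Φ (z + h) + Φ (z - h) := by
    have := hconv.2 (mem_univ (z + h)) (mem_univ (z - h)) (by norm_num : (0 : ℝ) ≤ 1 / 2)
      (by norm_num : (0 : ℝ) ≤ 1 / 2) (by norm_num)
    simp only [smul_eq_mul] at this
    rw [show 1 / 2 * (z + h) + 1 / 2 * (z - h) = z by ring] at this
    linarith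
  have hup : Φ (z + h) + Φ (z - h) - 2 * Φ z ≤ 6 * (C + l₂ + l₁) * (1 + z ^ 2) * h := by
    have s1 := hstep 1
    have s2 := hstep (-1)
    rw [mul_one] at s1
    rw [mul_neg, mul_one, ← sub_eq_add_neg, ← sub_eq_add_neg] at s2
    have b : Φ (z + 1) + Φ (z - 1) ≤ 6 * (C + l₂ + l₁) * (1 + z ^ 2) := by
      have hc : 0 ≤ C + l₂ + l₁ := by positivity
      have := mul_le_mul_of_nonneg_left (show (1 + (z + 1) ^ 2) + (1 + (z - 1) ^ 2)
        ≤ 6 * (1 + z ^ 2) by nlinarith [sq_nonneg z]) hc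
      nlinarith [hΦle (z + 1), hΦle (z - 1)]
    have b' := mul_le_mul_of_nonneg_right b hh.le
    nlinarith [hΦ0 z]
  have habs := _root_.abs_le.1 (abs_abs_second_difference_le z h)
  rw [abs_of_pos hh] at habs
  have e : W (z + h) + W (z - h) - 2 * W z = (Φ (z + h) + Φ (z - h) - 2 * Φ z)
      - l₂ * h ^ 2 - l₁ * (|z + h| + |z - h| - 2 * |z|) := by
    simp only [hΦ]; ring
  have m1 := mul_le_mul_of_nonneg_left habs.1 hl₁
  have m2 := mul_le_mul_of_nonneg_left habs.2 hl₁
  have m3 : 0 ≤ z ^ 2 * h := by positivity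
  have m4 : l₂ * h ^ 2 ≤ l₂ * h := mul_le_mul_of_nonneg_left (by nlinarith) hl₂
  have m5 := mul_nonneg hl₁ m3
  have m6 := mul_nonneg hl₂ m3
  have m7 : 0 ≤ (C + l₂ + l₁) * ((1 + z ^ 2) * h) := by positivity
  have m8 : 0 ≤ l₁ * h := by positivity
  have m9 : 0 ≤ l₂ * h ^ 2 := by positivity
  rw [e, _root_.abs_le]
  constructor <;> nlinarith

/-- The energy after splitting an atom. -/
lemma energy_splitAtom {W : ℝ → ℝ} (hW : IsPotential W) {μ : Measure ℝ} (hμ : IsP2 μ) (a h : ℝ) :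
    energy W (splitAtom μ a h) =
      1 / 2 * (∫ x in {a}ᶜ, ∫ y in {a}ᶜ, W (x - y) ∂μ ∂μ)
        + μ.real {a} / 2 * ((∫ y in {a}ᶜ, W (a - y + h) ∂μ) + ∫ y in {a}ᶜ, W (a - y - h) ∂μ)
        + (μ.real {a} / 2) ^ 2 * W (2 * h) := by
  have := hμ.isProbabilityMeasure
  obtain ⟨C, hC, hCW⟩ := hW.abs_le
  have hν := isP2_splitAtom hμ a h
  have := hν.isProbabilityMeasure
  have hWi : ∀ b, Integrable (fun y => W (b - y)) (μ.restrict {a}ᶜ) := fun b =>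
    (hμ.integrable_of_growth (hW.continuous.comp (by fun_prop))
      (growth_translate hC hCW b)).restrict
  have hW' : ∀ b y, W (y - b) = W (b - y) := fun b y => by rw [← hW.even, neg_sub]
  have hin : ∀ x, ∫ y, W (x - y) ∂(splitAtom μ a h) = (∫ y in {a}ᶜ, W (x - y) ∂μ)
      + μ.real {a} / 2 * (W (x - (a + h)) + W (x - (a - h))) := fun x =>
    integral_splitAtom h (hWi x)
  have hout : Integrable (fun x => ∫ y in {a}ᶜ, W (x - y) ∂μ) (μ.restrict {a}ᶜ) :=
    (integrable_prod_of_growth hμ.integrable_sq.restrict hμ.integrable_sq.restrict hW.continuous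
      hC hCW).integral_prod_left
  have hr : Integrable (fun x => μ.real {a} / 2 * (W (x - (a + h)) + W (x - (a - h))))
      (μ.restrict {a}ᶜ) := by
    simp only [hW' (a + h), hW' (a - h)]
    exact ((hWi _).add (hWi _)).const_mul _
  rw [energy, integral_prod _ (integrable_prod_of_growth hν.integrable_sq hν.integrable_sq
    hW.continuous hC hCW)]
  simp only [hin]
  have hsplit := integral_splitAtom h (hout.add hr)
  simp only [Pi.add_apply] at hsplit
  rw [hsplit, integral_add hout hr, integral_const_mul]
  have hrow : ∫ x in {a}ᶜ, (W (x - (a + h)) + W (x - (a - h))) ∂μ =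
      (∫ y in {a}ᶜ, W (a + h - y) ∂μ) + ∫ y in {a}ᶜ, W (a - h - y) ∂μ := by
    simp only [hW' (a + h), hW' (a - h)]
    exact integral_add (hWi _) (hWi _)
  rw [hrow]
  have e1 : ∀ y, a - y + h = a + h - y := fun y => by ring
  have e2 : ∀ y, a - y - h = a - h - y := fun y => by ring
  have e3 : a + h - (a - h) = 2 * h := by ring
  have e4 : a - h - (a + h) = -(2 * h) := by ring
  -- Of the four pairs of half-atoms, the two diagonal ones give `W 0 = 0` and the other two give `W
  -- (2 * h)` each.
  simp only [e1, e2, e3, e4, sub_self, hW.zero, hW.even]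
  ring

/-- The second difference quotients at a point of differentiability vanish in the limit. -/
lemma tendsto_second_difference {f : ℝ → ℝ} {z : ℝ} (hf : DifferentiableAt ℝ f z) :
    Tendsto (fun h : ℝ => (f (z + h) + f (z - h) - 2 * f z) / h) (𝓝[>] 0) (𝓝 0) := by
  have h1 : HasDerivAt (fun h : ℝ => f (z + h) + f (z - h) - 2 * f z) 0 0 := by
    have ha : HasDerivAt (fun h : ℝ => f (z + h)) (deriv f z) 0 := by
      have : HasDerivAt f (deriv f z) (z + 0) := by simpa using hf.hasDerivAt
      simpa using this.comp_const_add z 0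
    have hb : HasDerivAt (fun h : ℝ => f (z - h)) (-deriv f z) 0 := by
      have : HasDerivAt f (deriv f z) (z - 0) := by simpa using hf.hasDerivAt
      simpa using this.comp_const_sub z 0
    simpa using (ha.add hb).sub_const (2 * f z)
  have h2 := h1.tendsto_slope_zero_right
  refine h2.congr fun h => ?_
  simp only [zero_add, add_zero, sub_zero, smul_eq_mul]
  rw [show f z + f z - 2 * f z = 0 by ring, sub_zero, div_eq_inv_mul]

/-- Splitting an atom decreases the energy at first order in the displacement. -/
lemma eventually_energy_splitAtom_sub_le {W Wbar : ℝ → ℝ} {η : ℝ} (hW : IsPotential W)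
    (hWbar : Differentiable ℝ Wbar) (hdec : ∀ x : ℝ, W x = Wbar x + η * |x|) (hη : η < 0)
    {μ : Measure ℝ} (hμ : IsP2 μ) {a : ℝ} (ha : 0 < μ {a}) :
    ∀ᶠ h in 𝓝[>] (0 : ℝ), energy W (splitAtom μ a h) - energy W μ ≤
      η * (μ.real {a} / 2) ^ 2 * h := by
  have := hμ.isProbabilityMeasure
  set m := μ.real {a} / 2 with hm
  have hm0 : 0 < m := half_pos (ENNReal.toReal_pos ha.ne' (measure_ne_top _ _))
  obtain ⟨C, hC, hCW⟩ := hW.abs_le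
  obtain ⟨D, hD, hDW⟩ := hW.second_difference_le
  have hbar : ∀ x, Wbar x = W x - η * |x| := fun x => by rw [hdec]; ring
  have hWi : ∀ b, Integrable (fun y => W (b - y)) (μ.restrict {a}ᶜ) := fun b =>
    (hμ.integrable_of_growth (hW.continuous.comp (by fun_prop))
      (growth_translate hC hCW b)).restrict
  -- the regular part of the second difference
  have hlim : Tendsto (fun h : ℝ => ∫ y in {a}ᶜ,
      (Wbar (a - y + h) + Wbar (a - y - h) - 2 * Wbar (a - y)) / h ∂μ) (𝓝[>] 0)
      (𝓝 (∫ y in {a}ᶜ, (0 : ℝ) ∂μ)) := by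
    refine tendsto_integral_filter_of_dominated_convergence
      (fun y => D * (1 + (a - y) ^ 2) + 2 * |η|) ?_ ?_ ?_ ?_
    · have := hWbar.continuous
      exact Eventually.of_forall fun h => (by fun_prop : Continuous _).aestronglyMeasurable
    · filter_upwards [Ioc_mem_nhdsGT (zero_lt_one (α := ℝ))] with h hh
      refine Eventually.of_forall fun y => ?_
      rw [Real.norm_eq_abs, abs_div, abs_of_pos hh.1, div_le_iff₀ hh.1]
      have e : Wbar (a - y + h) + Wbar (a - y - h) - 2 * Wbar (a - y) =
          (W (a - y + h) + W (a - y - h) - 2 * W (a - y))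
          - η * (|a - y + h| + |a - y - h| - 2 * |a - y|) := by
        simp only [hbar]; ring
      rw [e]
      refine (abs_sub _ _).trans ?_
      rw [abs_mul]
      have i1 := hDW (a - y) h hh.1 hh.2
      have i2 := mul_le_mul_of_nonneg_left (abs_abs_second_difference_le (a - y) h) (abs_nonneg η)
      rw [abs_of_pos hh.1] at i2
      linarith
    · refine Integrable.restrict (Integrable.add ?_ (integrable_const _))
      exact hμ.integrable_of_growth (C := D * (2 + 2 * a ^ 2)) (by fun_prop)
        (growth_translate (F := fun z => D * (1 + z ^ 2)) hD
          (fun z => by rw [abs_of_nonneg (by positivity)]) a)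
    · exact Eventually.of_forall fun y => tendsto_second_difference (hWbar _)
  rw [integral_zero] at hlim
  -- the self-interaction of the atom
  have hself : Tendsto (fun h : ℝ => Wbar (2 * h) / h) (𝓝[>] 0) (𝓝 0) := by
    have hb0 : Wbar 0 = 0 := by simp [hbar, hW.zero]
    have hbe : ∀ x, Wbar (-x) = Wbar x := fun x => by simp [hbar, hW.even]
    -- Since `Wbar` is even and vanishes at `0`, this second difference is `2 * Wbar (2 * h)`.
    have h1 := (tendsto_second_difference (f := fun x => Wbar (2 * x)) (z := 0)
      (by fun_prop)).div_const 2
    rw [zero_div] at h1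
    refine h1.congr fun h => ?_
    simp only [zero_add, zero_sub, mul_neg, hbe, mul_zero, hb0]
    ring
  have htot := (hlim.const_mul m).add (hself.const_mul (m ^ 2))
  rw [mul_zero, mul_zero, add_zero] at htot
  -- The self-interaction gains `2 η m² h`; half of this gain absorbs the `o(h)` terms.
  have hpos : 0 < -η * m ^ 2 := mul_pos (neg_pos.2 hη) (by positivity)
  filter_upwards [htot.eventually_lt_const hpos, self_mem_nhdsWithin] with h hh hh0
  have hh0 : 0 < h := hh0
  have e0 : energy W μ = energy W (splitAtom μ a 0) := by rw [splitAtom_zero]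
  rw [e0, energy_splitAtom hW hμ, energy_splitAtom hW hμ, ← hm]
  simp only [add_zero, sub_zero, mul_zero, hW.zero]
  have hi1 : Integrable (fun y => W (a - y + h)) (μ.restrict {a}ᶜ) := by
    simpa only [show ∀ y, a - y + h = a + h - y from fun y => by ring] using hWi (a + h)
  have hi2 : Integrable (fun y => W (a - y - h)) (μ.restrict {a}ᶜ) := by
    simpa only [show ∀ y, a - y - h = a - h - y from fun y => by ring] using hWi (a - h)
  have hai : ∀ c, Integrable (fun y => η * |a - y + c|) (μ.restrict {a}ᶜ) := fun c =>
    (((((integrable_const a).sub (hμ.moment.integrable (by norm_num))).add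
      (integrable_const c)).abs).const_mul η).restrict
  -- The part `η|x|` of `W` can be dropped: its second difference is nonpositive, as `|x|` is convex
  -- and `η < 0`.
  have key : (∫ y in {a}ᶜ, W (a - y + h) ∂μ) + (∫ y in {a}ᶜ, W (a - y - h) ∂μ)
      - 2 * (∫ y in {a}ᶜ, W (a - y) ∂μ) ≤
      h * ∫ y in {a}ᶜ, (Wbar (a - y + h) + Wbar (a - y - h) - 2 * Wbar (a - y)) / h ∂μ := by
    rw [← integral_const_mul, ← integral_const_mul, ← integral_add' hi1 hi2,
      ← integral_sub (hi1.add hi2) ((hWi a).const_mul 2)]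
    refine integral_mono ((hi1.add hi2).sub ((hWi a).const_mul 2)) ?_ fun y => ?_
    · have : ∀ y, h * ((Wbar (a - y + h) + Wbar (a - y - h) - 2 * Wbar (a - y)) / h) =
          (W (a - y + h) + W (a - y - h) - 2 * W (a - y))
          - (η * |a - y + h| + η * |a - y + -h| - 2 * (η * |a - y + 0|)) := fun y => by
        rw [mul_div_cancel₀ _ hh0.ne', ← sub_eq_add_neg, add_zero]
        simp only [hbar]; ring
      simp only [this]
      exact ((hi1.add hi2).sub ((hWi a).const_mul 2)).sub
        (((hai h).add (hai (-h))).sub ((hai 0).const_mul 2))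
    · have h2 : 2 * |a - y| ≤ |a - y + h| + |a - y - h| := by
        have := abs_add_le (a - y + h) (a - y - h)
        rwa [show a - y + h + (a - y - h) = 2 * (a - y) by ring, abs_mul, abs_two] at this
      have h3 := mul_le_mul_of_nonpos_left h2 hη.le
      simp only [Pi.add_apply]
      rw [mul_div_cancel₀ _ hh0.ne', hdec, hdec, hdec]
      linarith
  have key2 := mul_le_mul_of_nonneg_left key hm0.le
  have hW2 : W (2 * h) = h * (Wbar (2 * h) / h) + 2 * η * h := by
    rw [hdec, abs_of_pos (by positivity), mul_div_cancel₀ _ hh0.ne']; ring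
  have hfin := mul_lt_mul_of_pos_right hh hh0
  rw [hW2]
  nlinarith

/-! ### Atoms and the subdifferential -/

/-- If the potential has a repulsive Lipschitz singularity, the interaction energy has empty
subdifferential at every measure with an atom. -/
theorem notMem_subdifferential_of_atom {W Wbar : ℝ → ℝ} {η : ℝ} (hW : IsPotential W)
    (hWbar : Differentiable ℝ Wbar) (hdec : ∀ x : ℝ, W x = Wbar x + η * |x|) (hη : η < 0)
    {μ : Measure ℝ} (hμ : IsP2 μ) {a : ℝ} (ha : 0 < μ {a}) (k : ℝ → ℝ) :
    k ∉ subdifferential (energy W) μ := by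
  rintro ⟨hk, hsub⟩
  have := hμ.isProbabilityMeasure
  set c := -η * (μ.real {a} / 2) ^ 2 with hc
  have hc0 : 0 < c := mul_pos (neg_pos.2 hη)
    (pow_pos (half_pos (ENNReal.toReal_pos ha.ne' (measure_ne_top _ _))) 2)
  -- The drop `c h` has to beat three errors of at most `c h / 4`: the `o(W2)` term, the linear term
  -- and `K h²`.
  obtain ⟨δ, hδ, hδs⟩ := hsub (c / 4) (by positivity)
  obtain ⟨K, hK, hlin⟩ := linear_term_splitAtom hμ hk a (ε := c / 4) (by positivity)
  have hsmall : ∀ᶠ h in 𝓝[>] (0 : ℝ), K * h < c / 4 := by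
    have : Tendsto (fun h : ℝ => K * h) (𝓝[>] 0) (𝓝 (K * 0)) :=
      ((continuous_const_mul K).tendsto 0).mono_left nhdsWithin_le_nhds
    rw [mul_zero] at this
    exact this.eventually_lt_const (by positivity)
  obtain ⟨h, hE, hKh, hh0, hhδ⟩ :=
    ((eventually_energy_splitAtom_sub_le hW hWbar hdec hη hμ ha).and
      (hsmall.and (Ioo_mem_nhdsGT hδ))).exists
  have hW2 := W2_splitAtom_le μ a hh0.le
  have hlow := hδs _ (isP2_splitAtom hμ a h) (hW2.trans_lt hhδ)
  have hinf : -(c / 4 * h + K * h ^ 2) ≤ sInf ((fun γ : Measure (ℝ × ℝ) =>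
      ∫ p, k p.1 * (p.2 - p.1) ∂γ) '' optimalPlans μ (splitAtom μ a h)) := by
    -- The bound is nonpositive, so it also covers `sInf ∅ = 0`, and existence of an optimal plan is
    -- not needed.
    refine Real.le_sInf ?_ (neg_nonpos.2 (by positivity))
    rintro _ ⟨γ, ⟨hγ, hopt⟩, rfl⟩
    exact hlin h hh0 γ hγ ((hopt _ (splitPlan_mem_plans μ a h)).trans (cost_splitPlan_le μ a h))
  have h1 : c / 4 * W2 μ (splitAtom μ a h) ≤ c / 4 * h :=
    mul_le_mul_of_nonneg_left hW2 (by positivity)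
  have h2 : K * h ^ 2 ≤ c / 4 * h := by nlinarith
  have h3 : energy W (splitAtom μ a h) - energy W μ ≤ -c * h := by
    rw [hc]; linarith
  have h4 : 0 < c * h := mul_pos hc0 hh0
  linarith

end OneDimInteraction

theorem mainTheorem3 (W Wbar : ℝ → ℝ) (η : ℝ)
    (hW : IsPotential W)
    (hWbar : ContDiff ℝ 1 Wbar)
    (hdec : ∀ x : ℝ, W x = Wbar x + η * |x|)
    (hη : η < 0) :
    (∀ μ : Measure ℝ, IsP2 μ → (∃ xbar : ℝ, 0 < μ {xbar}) →
      field W μ ∉ subdifferential (energy W) μ) ∧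
    (∀ μ : ℝ → Measure ℝ, IsGradientFlow (energy W) μ →
      ∀ᵐ t ∂(volume.restrict (Ioi (0 : ℝ))), ∀ x : ℝ, μ t {x} = 0) := by
  have hd : Differentiable ℝ Wbar := hWbar.differentiable one_ne_zero
  refine ⟨fun μ hμ ⟨a, ha⟩ => notMem_subdifferential_of_atom hW hd hdec hη hμ ha _, ?_⟩
  rintro μ ⟨hac, v, -, -, -, -, hsub⟩
  filter_upwards [hsub, ae_restrict_mem measurableSet_Ioi] with t ht ht0 x
  by_contra hx
  exact notMem_subdifferential_of_atom hW hd hdec hη (hac.1 t ht0) (pos_iff_ne_zero.2 hx) _ ht
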